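/- Let $\kappa$ be a field, $r\ge 0$ an integer, and let $H_r(-)$ denote singular homology with coefficients in $\kappa$. For a continuous map $f:X\to\mathbb R$ put $X_t=f^{-1}(t)$ and $X_{a,b}=f^{-1}([a,b])$ for $a\le b$. The map $f$ is called \emph{tame} with critical values $t_1<\dots<t_N$ if $X$ is compact, $t_1=\min f(X)$, $t_N=\max f(X)$, and (i) for every $t\notin\{t_1,\dots,t_N\}$ there is $\epsilon>0$ such that $f:f^{-1}(t-\epsilon,t+\epsilon)\to(t-\epsilon,t+\epsilon)$ and the projection $X_t\times(t-\epsilon,t+\epsilon)\to(t-\epsilon,t+\epsilon)$ are fiber-wise homotopy equivalent; (ii) for every $i$ there is $\epsilon>0$ such that the inclusions $X_{t_i}\hookrightarrow X_{t_i,t_i+\epsilon}$ and $X_{t_i}\hookrightarrow X_{t_i-\epsilon,t_i}$ are deformation retractions (the homotopy from the identity to the retraction fixes $X_{t_i}$ pointwise). For $u\le s\le t$ put $L_r^+(s;t)=\ker(H_r(X_s)\to H_r(X_{s,t}))$ and $L_r^-(s;u)=\ker(H_r(X_s)\to H_r(X_{u,s}))$, the maps being induced by inclusion, and let $l_r(s)$,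 $l_r^+(s;t)$, $l_r^-(s;u)$, $e_r(s;t,u)$ be the dimensions of $H_r(X_s)$, $L_r^+(s;t)$, $L_r^-(s;u)$ and $L_r^+(s;t)\cap L_r^-(s;u)$. Write $t_{i+1/2}=(t_i+t_{i+1})/2$ for $1\le i\le N-1$, and $t_0=-\infty$, $t_{N+1}=+\infty$. \textbf{Proposition.} Let $f:X\to\mathbb R$ be tame with critical values $t_1<\dots<t_N$. (a) Let $t_1\le u<s<t\le t_N$. There are $k,i,j$ with $t_{k-1}<u\le t_k$, $t_i\le s<t_{i+1}$, $t_j\le t<t_{j+1}$, and for these there are isomorphisms of $\kappa$-vector spaces: 1. $H_r(X_s)\cong H_r(X_{t_i})$ if $s=t_i$, and $H_r(X_s)\cong H_r(X_{t_{i+1/2}})$ if $t_i<s<t_{i+1}$. 2. $L_r^+(s;t)\cong L_r^+(t_i;t_j)$ if $s=t_i$; $L_r^+(s;t)\cong L_r^+(t_{i+1/2};t_j)$ if $t_i<s<t_{i+1}\le t$; $L_r^+(s;t)=0$ if $t_i<s<t<t_{i+1}$. 3. $L_r^-(s;u)\cong L_r^-(t_i;t_k)$ if $s=t_i$; $L_r^-(s;u)\cong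 L_r^-(t_{i+1/2};t_k)$ if $u\le t_i<s<t_{i+1}$; $L_r^-(s;u)=0$ if $t_i<u<s<t_{i+1}$. 4. $L_r^+(s;t)\cap L_r^-(s;u)$ is isomorphic to $L_r^+(t_i;t_j)\cap L_r^-(t_i;t_k)$ if $s=t_i$, to $L_r^+(t_{i+1/2};t_j)\cap L_r^-(t_{i+1/2};t_k)$ if $u\le t_i<s<t_{i+1}\le t$, and is $0$ otherwise. (b) Consequently, for $t_1\le u\le s\le t\le t_N$ the numbers $l_r(s)$, $l_r^+(s;t)$, $l_r^-(s;u)$, $e_r(s;t,u)$ are determined by finitely many of them: let $t_{k-1}<u\le t_k$, $t_j\le t<t_{j+1}$, and let $\sigma=s$ if $s$ is a critical value, $\sigma=t_{i+1/2}$ if $t_i<s<t_{i+1}$ (such $k$, $j$, $\sigma$ exist). Then $l_r(s)=l_r(\sigma)$; $l_r^+(s;t)=l_r^+(\sigma;t_j)$ if $\sigma\le t_j$, and $=0$ otherwise; $l_r^-(s;u)=l_r^-(\sigma;t_k)$ if $t_k\le\sigma$, and $=0$ otherwise; $e_r(s;t,u)=e_r(\sigma;t_j,t_k)$ if $t_k\le\sigma\le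 t_j$, and $=0$ otherwise. Dimensions are understood as cardinal numbers. -/

import Mathlib

open CategoryTheory AlgebraicTopology

universe u v

/-- The `r`-th singular homology, with coefficients in the field `κ`, of a subset `A` of a
topological space, regarded as a topological space with the subspace topology. -/
noncomputable def singH (κ : Type u) [Field κ] (r : ℕ) {X : Type v} [TopologicalSpace X]
    (A : Set X) : ModuleCat.{max u v} κ :=
  ((singularHomologyFunctor.{v} (ModuleCat.{max u v} κ) r).obj
    (ModuleCat.of κ (ULift.{max u v} κ))).obj (TopCat.of A)

/-- The linear map `H_r(A) → H_r(B)` induced by an inclusion `A ⊆ B`. -/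
noncomputable def singHIncl (κ : Type u) [Field κ] (r : ℕ) {X : Type v} [TopologicalSpace X]
    {A B : Set X} (h : A ⊆ B) : singH κ r A →ₗ[κ] singH κ r B :=
  (((singularHomologyFunctor.{v} (ModuleCat.{max u v} κ) r).obj
    (ModuleCat.of κ (ULift.{max u v} κ))).map
      (TopCat.ofHom ⟨Set.inclusion h, continuous_inclusion h⟩)).hom

/-- The level `X_t = f⁻¹(t)`. -/
def level {X : Type v} (f : X → ℝ) (t : ℝ) : Set X := f ⁻¹' {t}

/-- The interlevel set `X_{a,b} = f⁻¹([a,b])` for `a ≤ b` (the two ends may be given in either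
order, so that an end level is always contained in it). -/
def interlevel {X : Type v} (f : X → ℝ) (a b : ℝ) : Set X := f ⁻¹' Set.uIcc a b

theorem interlevel_of_le {X : Type v} (f : X → ℝ) {a b : ℝ} (h : a ≤ b) :
    interlevel f a b = f ⁻¹' Set.Icc a b := by
  rw [interlevel, Set.uIcc_of_le h]

theorem level_subset_left {X : Type v} (f : X → ℝ) (a b : ℝ) :
    level f a ⊆ interlevel f a b := by
  rintro x rfl
  exact Set.left_mem_uIcc

theorem level_subset_right {X : Type v} (f : X → ℝ) (a b : ℝ) :
    level f b ⊆ interlevel f a b := by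
  rintro x rfl
  exact Set.right_mem_uIcc

/-- `L⁺_r(s;t) = ker (H_r(X_s) → H_r(X_{s,t}))`, for `s ≤ t`. -/
noncomputable def upKer (κ : Type u) [Field κ] (r : ℕ) {X : Type v} [TopologicalSpace X]
    (f : X → ℝ) (s t : ℝ) : Submodule κ (singH κ r (level f s)) :=
  LinearMap.ker (singHIncl κ r (level_subset_left f s t))

/-- `L⁻_r(s;u) = ker (H_r(X_s) → H_r(X_{u,s}))`, for `u ≤ s`. -/
noncomputable def downKer (κ : Type u) [Field κ] (r : ℕ) {X : Type v} [TopologicalSpace X]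
    (f : X → ℝ) (s u : ℝ) : Submodule κ (singH κ r (level f s)) :=
  LinearMap.ker (singHIncl κ r (level_subset_right f u s))

/-- The relevant level persistence number `l_r(s) = dim H_r(X_s)`. -/
noncomputable def persL (κ : Type u) [Field κ] (r : ℕ) {X : Type v} [TopologicalSpace X]
    (f : X → ℝ) (s : ℝ) : Cardinal.{max u v} :=
  Module.rank κ (singH κ r (level f s))

/-- The relevant level persistence number `l⁺_r(s;t) = dim L⁺_r(s;t)`. -/
noncomputable def persUp (κ : Type u) [Field κ] (r : ℕ) {X : Type v} [TopologicalSpace X]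
    (f : X → ℝ) (s t : ℝ) : Cardinal.{max u v} :=
  Module.rank κ (upKer κ r f s t)

/-- The relevant level persistence number `l⁻_r(s;u) = dim L⁻_r(s;u)`. -/
noncomputable def persDown (κ : Type u) [Field κ] (r : ℕ) {X : Type v} [TopologicalSpace X]
    (f : X → ℝ) (s u : ℝ) : Cardinal.{max u v} :=
  Module.rank κ (downKer κ r f s u)

/-- The relevant level persistence number `e_r(s;t,u) = dim (L⁺_r(s;t) ∩ L⁻_r(s;u))`. -/
noncomputable def persE (κ : Type u) [Field κ] (r : ℕ) {X : Type v} [TopologicalSpace X]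
    (f : X → ℝ) (s t u : ℝ) : Cardinal.{max u v} :=
  Module.rank κ (upKer κ r f s t ⊓ downKer κ r f s u : Submodule κ (singH κ r (level f s)))

/-- `A` is a deformation retract of `Y`: there is a homotopy from the identity of `Y` to a map
with values in `A`, which fixes every point of `A` at all times. -/
def IsDeformationRetract {Y : Type v} [TopologicalSpace Y] (A : Set Y) : Prop :=
  ∃ ρ : C(Y, Y), (∀ y, ρ y ∈ A) ∧ (ContinuousMap.id Y).HomotopicRel ρ A

/-- `p : E → B` and `q : E' → B` are fiber-wise homotopy equivalent: there are maps over `B` in both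
directions whose composites are homotopic to the identities through maps over `B`. -/
def FiberwiseHomotopyEquivalent {E E' : Type v} {B : Type} [TopologicalSpace E]
    [TopologicalSpace E'] (p : E → B) (q : E' → B) : Prop :=
  ∃ (φ : C(E, E')) (ψ : C(E', E)), (∀ x, q (φ x) = p x) ∧ (∀ y, p (ψ y) = q y) ∧
    (∃ H : ContinuousMap.Homotopy (ψ.comp φ) (ContinuousMap.id E), ∀ τ x, p (H (τ, x)) = p x) ∧
    (∃ H : ContinuousMap.Homotopy (φ.comp ψ) (ContinuousMap.id E'), ∀ τ y, q (H (τ, y)) = q y)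

/-- `f : X → ℝ` is a tame map with critical values `c 0 < c 1 < ⋯ < c N`. -/
structure IsTame {X : Type v} [TopologicalSpace X] (f : X → ℝ) {N : ℕ} (c : Fin (N + 1) → ℝ) :
    Prop where
  continuous : Continuous f
  compact : CompactSpace X
  strictMono : StrictMono c
  isLeast : IsLeast (Set.range f) (c 0)
  isGreatest : IsGreatest (Set.range f) (c (Fin.last N))
  regular : ∀ t : ℝ, t ∉ Set.range c → ∃ ε > 0,
    FiberwiseHomotopyEquivalent
      (Set.restrictPreimage (Set.Ioo (t - ε) (t + ε)) f)
      (Prod.snd : level f t × Set.Ioo (t - ε) (t + ε) → Set.Ioo (t - ε) (t + ε))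
  critical : ∀ i : Fin (N + 1), ∃ ε > 0,
    IsDeformationRetract (Y := interlevel f (c i) (c i + ε)) (Subtype.val ⁻¹' level f (c i)) ∧
    IsDeformationRetract (Y := interlevel f (c i - ε) (c i)) (Subtype.val ⁻¹' level f (c i))

/-- The midpoint `t_{i+1/2} = (t_i + t_{i+1}) / 2`. -/
noncomputable def midValue {N : ℕ} (c : Fin (N + 1) → ℝ) (i : Fin N) : ℝ :=
  (c i.castSucc + c i.succ) / 2

/-- `t_{k-1} < u ≤ t_k`, where the first inequality is void for the first index `k`. -/
def IsCeilIndex {N : ℕ} (c : Fin (N + 1) → ℝ) (u : ℝ) (k : Fin (N + 1)) : Prop :=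
  u ≤ c k ∧ ∀ l, l < k → c l < u

/-- `t_j ≤ t < t_{j+1}`, where the second inequality is void for the last index `j`. -/
def IsFloorIndex {N : ℕ} (c : Fin (N + 1) → ℝ) (t : ℝ) (j : Fin (N + 1)) : Prop :=
  c j ≤ t ∧ ∀ l, j < l → t < c l

/-- `σ` is the representative of the value `s`: a critical value represents itself, and
`t_{i+1/2}` represents all values strictly between `t_i` and `t_{i+1}`. -/
def IsRepresentative {N : ℕ} (c : Fin (N + 1) → ℝ) (s σ : ℝ) : Prop :=
  (∃ i, s = c i ∧ σ = c i) ∨ (∃ i : Fin N, c i.castSucc < s ∧ s < c i.succ ∧ σ = midValue c i)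

/-!
The homology of levels and slices changes only when a critical value is met. The precise form of
this used here is `IsLocallyTame.bijective_of_disjoint_Ioc`: if `a ≤ b ≤ d` and there is no critical
value in `(b, d]`, then the inclusion `X_{a,b} ⊆ X_{a,d}` induces isomorphisms in homology; and its
mirror image `IsLocallyTame.bijective_of_disjoint_Ico`. The hypotheses on a tame map are first
rewritten in a form, `IsLocallyTame`, that is invariant under replacing `f` by `-f`, so that the
mirror image comes for free.

No excision is needed, only homotopy invariance. Near a regular value a fiberwise homotopy
equivalence with a product allows points to be transported between fibers. Cutting off the fiberwise
homotopy below `b` yields a deformation of `X_{a,d}` which preserves `X_{a,b}` and pushes everything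
into it (`bijective_singHIncl_of_local`); a subdivision of `[b, d]` makes this global when `[b, d]`
consists of regular values. If `b` is critical, the deformation retraction of a slice above the
level of `b` is used. That slice may be much thicker than `[b, d]`, but since the homotopy fixes the
level of `b` and `X` is compact, a thin slice over `[b, δ]` stays over `[b, d]` throughout the
homotopy, and this suffices because the slices over `[b, δ]` and `[b, d]` have the same homology.

The rest is linear algebra. Kernels do not change when `t` moves down to the critical value below it
and `u` up to the one above it. For two values `s` and `σ` in the same interval between consecutive
critical values, the homology of the slice between them identifies `H_r(X_s)` with `H_r(X_σ)`,
compatibly with both kernels at once, hence with their intersection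
(`IsTame.exists_equiv_representative`).
-/

/-! ### Homotopies and homology of subsets -/

section Homology

variable (κ : Type u) [Field κ] (r : ℕ) {X : Type v} [TopologicalSpace X]

/-- The map induced in singular homology by a continuous map between subsets of a space. -/
noncomputable def singMap {A B : Set X} (g : C(A, B)) : singH κ r A →ₗ[κ] singH κ r B :=
  (((singularHomologyFunctor.{v} (ModuleCat.{max u v} κ) r).obj
    (ModuleCat.of κ (ULift.{max u v} κ))).map (TopCat.ofHom g)).hom

theorem singHIncl_eq_singMap {A B : Set X} (h : A ⊆ B) :
    singHIncl κ r h = singMap κ r ⟨Set.inclusion h, continuous_inclusion h⟩ := rfl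

theorem singMap_id (A : Set X) : singMap κ r (ContinuousMap.id A) = LinearMap.id := by
  unfold singMap
  rw [TopCat.ofHom_id, CategoryTheory.Functor.map_id]
  rfl

theorem singMap_comp {A B C : Set X} (g : C(B, C)) (h : C(A, B)) :
    singMap κ r (g.comp h) = singMap κ r g ∘ₗ singMap κ r h := by
  unfold singMap
  rw [TopCat.ofHom_comp, CategoryTheory.Functor.map_comp]
  rfl

theorem singMap_eq_of_homotopic {A B : Set X} {g h : C(A, B)} (H : g.Homotopic h) :
    singMap κ r g = singMap κ r h := by
  obtain ⟨H⟩ := H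
  have H' : TopCat.Homotopy (TopCat.ofHom g) (TopCat.ofHom h) := H
  exact congrArg ModuleCat.Hom.hom
    (H'.congr_homologyMap_singularChainComplexFunctor (ModuleCat.of κ (ULift.{max u v} κ)) r)

theorem singHIncl_comp {A B C : Set X} (h : A ⊆ B) (h' : B ⊆ C) :
    singHIncl κ r (h.trans h') = singHIncl κ r h' ∘ₗ singHIncl κ r h := by
  simp only [singHIncl_eq_singMap]
  rw [← singMap_comp]
  rfl

theorem bijective_singHIncl_of_eq {A B : Set X} (e : A = B) (h : A ⊆ B) :
    Function.Bijective (singHIncl κ r h) := by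
  subst e
  have : singHIncl κ r h = LinearMap.id := singMap_id κ r A
  rw [this]
  exact Function.bijective_id

end Homology

section HomotopicOn

variable {X : Type v} [TopologicalSpace X]

/-- The functions `g` and `k` restrict to continuous maps `V → W` which are homotopic. The
functions are total so that gluing them requires no subtypes; their values outside `V` are
irrelevant. -/
def HomotopicOn (V W : Set X) (g k : X → X) : Prop :=
  ∃ g' k' : C(V, W), (∀ x, (g' x : X) = g x) ∧ (∀ x, (k' x : X) = k x) ∧ g'.Homotopic k'

theorem HomotopicOn.trans {V W : Set X} {g h k : X → X} (h₁ : HomotopicOn V W g h)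
    (h₂ : HomotopicOn V W h k) : HomotopicOn V W g k := by
  obtain ⟨g', h', hg, hh, H⟩ := h₁
  obtain ⟨h'', k', hh', hk, K⟩ := h₂
  have : h' = h'' := by
    ext x
    rw [hh, hh']
  subst this
  exact ⟨g', k', hg, hk, H.trans K⟩

theorem HomotopicOn.of_continuousOn {V W : Set X} (F : unitInterval × X → X)
    (hF : ContinuousOn F (Set.univ ×ˢ V)) (hW : ∀ τ, ∀ x ∈ V, F (τ, x) ∈ W) :
    HomotopicOn V W (fun x ↦ F (0, x)) (fun x ↦ F (1, x)) := by
  have hc : Continuous fun p : unitInterval × V ↦ (⟨F (p.1, p.2), hW p.1 p.2 p.2.2⟩ : W) :=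
    Continuous.subtype_mk (hF.comp_continuous (f := fun p : unitInterval × V ↦ (p.1, (p.2 : X)))
      (by fun_prop) fun p ↦ ⟨trivial, p.2.2⟩) _
  exact ⟨⟨fun x ↦ ⟨F (0, x), hW 0 x x.2⟩, hc.comp (by fun_prop : Continuous fun x : V ↦ ((0 : unitInterval), x))⟩,
    ⟨fun x ↦ ⟨F (1, x), hW 1 x x.2⟩, hc.comp (by fun_prop : Continuous fun x : V ↦ ((1 : unitInterval), x))⟩,
    fun _ ↦ rfl, fun _ ↦ rfl, ⟨⟨⟨_, hc⟩, fun _ ↦ rfl, fun _ ↦ rfl⟩⟩⟩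

theorem HomotopicOn.congr {V W : Set X} {g h g' h' : X → X} (H : HomotopicOn V W g h)
    (hg : Set.EqOn g g' V) (hh : Set.EqOn h h' V) : HomotopicOn V W g' h' := by
  obtain ⟨a, b, ha, hb, H⟩ := H
  exact ⟨a, b, fun x ↦ (ha x).trans (hg x.2), fun x ↦ (hb x).trans (hh x.2), H⟩

/-- A criterion for an inclusion `A ⊆ W` to induce isomorphisms in homology: some intermediate
`V`, with the same homology as `W`, can be deformed inside `W` into `A`, while `A` stays in
itself. -/
theorem bijective_singHIncl_of_homotopicOn (κ : Type u) [Field κ] (r : ℕ) {A V W : Set X}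
    (hAV : A ⊆ V) (hVW : V ⊆ W) (hb : Function.Bijective (singHIncl κ r hVW)) {k : X → X}
    (hV : HomotopicOn V W id k) (hA : HomotopicOn A A id k) (hk : Set.MapsTo k V A) (h : A ⊆ W) :
    Function.Bijective (singHIncl κ r h) := by
  obtain ⟨i, k', hi, hk', H⟩ := hV
  obtain ⟨j, l, hj, hl, K⟩ := hA
  let ρ : C(V, A) := ⟨fun x ↦ ⟨k x, hk x.2⟩, Continuous.subtype_mk
    ((continuous_subtype_val.comp k'.continuous).congr hk') _⟩
  have e₁ : singHIncl κ r h ∘ₗ singMap κ r ρ = singHIncl κ r hVW := by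
    rw [singHIncl_eq_singMap, singHIncl_eq_singMap, ← singMap_comp]
    refine (singMap_eq_of_homotopic κ r ?_).symm
    convert H using 1
    · ext x
      exact (hi x).symm
    · ext x
      exact (hk' x).symm
  have e₂ : singMap κ r ρ ∘ₗ singHIncl κ r hAV = LinearMap.id := by
    rw [singHIncl_eq_singMap, ← singMap_comp, ← singMap_id]
    refine (singMap_eq_of_homotopic κ r ?_).symm
    convert K using 1
    · ext x
      exact (hj x).symm
    · ext x
      exact (hl x).symm
  refine ⟨?_, Function.Surjective.of_comp (g := singMap κ r ρ) ?_⟩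
  · rw [singHIncl_comp κ r hAV hVW, LinearMap.coe_comp]
    refine hb.1.comp (Function.Injective.of_comp (f := singMap κ r ρ) ?_)
    rw [← LinearMap.coe_comp, e₂]
    exact Function.injective_id
  · rw [← LinearMap.coe_comp, e₁]
    exact hb.2

end HomotopicOn

/-! ### Local structure of a tame map -/

section LocalStructure

variable {X : Type v} [TopologicalSpace X]

/-- Over an interval around `t` the fibers of `f` can be transported to one another: `T (x, y)`
transports `x` to the fiber over `y`, and transporting `x` to its own fiber is homotopic, through
fiber-preserving maps `S (τ, ·)`, to leaving it in place. -/
def HasLocalTransport (f : X → ℝ) (t : ℝ) : Prop :=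
  ∃ ε > 0, ∃ (S : unitInterval × X → X) (T : X × ℝ → X),
    ContinuousOn S (Set.univ ×ˢ (f ⁻¹' Set.Ioo (t - ε) (t + ε))) ∧
    ContinuousOn T ((f ⁻¹' Set.Ioo (t - ε) (t + ε)) ×ˢ Set.Ioo (t - ε) (t + ε)) ∧
    (∀ x ∈ f ⁻¹' Set.Ioo (t - ε) (t + ε), (∀ τ, f (S (τ, x)) = f x) ∧ S (0, x) = x ∧
      S (1, x) = T (x, f x) ∧ ∀ y ∈ Set.Ioo (t - ε) (t + ε), f (T (x, y)) = y)

/-- The level of `c` is a deformation retract of the part of `X` slightly above it, as witnessed by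
the homotopy `F`. Only `c ≤ f (F (τ, x))` is asked of the intermediate positions: no upper bound on
them is needed. -/
def RetractsFromAbove (f : X → ℝ) (c : ℝ) : Prop :=
  ∃ ε > 0, ∃ F : unitInterval × X → X,
    ContinuousOn F (Set.univ ×ˢ (f ⁻¹' Set.Icc c (c + ε))) ∧
    (∀ τ, ∀ x ∈ f ⁻¹' Set.Icc c (c + ε), c ≤ f (F (τ, x))) ∧
    (∀ x ∈ f ⁻¹' Set.Icc c (c + ε), F (0, x) = x ∧ f (F (1, x)) = c) ∧
    ∀ τ x, f x = c → F (τ, x) = x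

/-- A form of tameness, with set of critical values `C`, that is visibly invariant under the
reversal of the real line. -/
structure IsLocallyTame (f : X → ℝ) (C : Set ℝ) : Prop where
  continuous : Continuous f
  compact : CompactSpace X
  transport : ∀ t ∉ C, HasLocalTransport f t
  above : ∀ t ∈ C, RetractsFromAbove f t
  below : ∀ t ∈ C, RetractsFromAbove (fun x ↦ -f x) (-t)

theorem HasLocalTransport.neg {f : X → ℝ} {t : ℝ} (h : HasLocalTransport f t) :
    HasLocalTransport (fun x ↦ -f x) (-t) := by
  obtain ⟨ε, hε, S, T, hS, hT, h⟩ := h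
  have hJ : ∀ y : ℝ, -y ∈ Set.Ioo (t - ε) (t + ε) ↔ y ∈ Set.Ioo (-t - ε) (-t + ε) := by
    intro y
    constructor <;> rintro ⟨h₁, h₂⟩ <;> constructor <;> linarith
  have hJ' : (fun x ↦ -f x) ⁻¹' Set.Ioo (-t - ε) (-t + ε) = f ⁻¹' Set.Ioo (t - ε) (t + ε) := by
    ext x
    simpa using (hJ (-f x)).symm
  refine ⟨ε, hε, S, fun p ↦ T (p.1, -p.2), by rwa [hJ'], ?_, ?_⟩
  · rw [hJ']
    exact hT.comp (by fun_prop) fun p hp ↦ ⟨hp.1, (hJ _).2 hp.2⟩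
  · rw [hJ']
    intro x hx
    obtain ⟨h₁, h₂, h₃, h₄⟩ := h x hx
    refine ⟨fun τ ↦ congrArg Neg.neg (h₁ τ), h₂, by simpa using h₃, fun y hy ↦ ?_⟩
    exact (congrArg Neg.neg (h₄ _ ((hJ y).2 hy))).trans (neg_neg y)

theorem IsLocallyTame.neg {f : X → ℝ} {C : Set ℝ} (h : IsLocallyTame f C) :
    IsLocallyTame (fun x ↦ -f x) (-C) where
  continuous := h.continuous.neg
  compact := h.compact
  transport t ht := by
    simpa using (h.transport (-t) ht).neg
  above t ht := by
    simpa using h.below (-t) ht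
  below t ht := by
    simpa using h.above (-t) ht

theorem hasLocalTransport_of_fiberwiseHomotopyEquivalent {f : X → ℝ} {t ε : ℝ} (hε : 0 < ε)
    (h : FiberwiseHomotopyEquivalent
      (Set.restrictPreimage (Set.Ioo (t - ε) (t + ε)) f)
      (Prod.snd : level f t × Set.Ioo (t - ε) (t + ε) → Set.Ioo (t - ε) (t + ε))) :
    HasLocalTransport f t := by
  classical
  set J := Set.Ioo (t - ε) (t + ε)
  obtain ⟨φ, ψ, hφ, hψ, ⟨H, hH⟩, -⟩ := h
  -- The homotopy runs from `ψ ∘ φ` to the identity, hence the reversed time parameter.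
  let S : unitInterval × X → X := fun p ↦
    if hx : p.2 ∈ f ⁻¹' J then (H (unitInterval.symm p.1, ⟨p.2, hx⟩) : X) else p.2
  let T : X × ℝ → X := fun p ↦
    if hx : p.1 ∈ f ⁻¹' J ∧ p.2 ∈ J then (ψ ((φ ⟨p.1, hx.1⟩).1, ⟨p.2, hx.2⟩) : X) else p.1
  have hS : ∀ τ (x : f ⁻¹' J), S (τ, x) = H (unitInterval.symm τ, x) := by
    intro τ x
    simp only [S]
    rw [dif_pos x.2]
  have hT : ∀ (x : f ⁻¹' J) (y : J), T (x, y) = ψ ((φ x).1, y) := by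
    intro x y
    simp only [T]
    rw [dif_pos ⟨x.2, y.2⟩]
  refine ⟨ε, hε, S, T, ?_, ?_, ?_⟩
  · rw [continuousOn_iff_continuous_domRestrict]
    have : Continuous fun p : (Set.univ ×ˢ (f ⁻¹' J) : Set (unitInterval × X)) ↦
        (H (unitInterval.symm p.1.1, ⟨p.1.2, p.2.2⟩) : X) := by
      fun_prop
    exact this.congr fun p ↦ (hS p.1.1 ⟨p.1.2, p.2.2⟩).symm
  · rw [continuousOn_iff_continuous_domRestrict]
    have : Continuous fun p : ((f ⁻¹' J) ×ˢ J : Set (X × ℝ)) ↦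
        (ψ ((φ ⟨p.1.1, p.2.1⟩).1, ⟨p.1.2, p.2.2⟩) : X) := by
      fun_prop
    exact this.congr fun p ↦ (hT ⟨p.1.1, p.2.1⟩ ⟨p.1.2, p.2.2⟩).symm
  · intro x hx
    have hfx : (φ ⟨x, hx⟩).2 = ⟨f x, hx⟩ := hφ ⟨x, hx⟩
    refine ⟨fun τ ↦ ?_, ?_, ?_, fun y hy ↦ ?_⟩
    · rw [hS τ ⟨x, hx⟩]
      exact congrArg Subtype.val (hH (unitInterval.symm τ) ⟨x, hx⟩)
    · rw [hS 0 ⟨x, hx⟩, unitInterval.symm_zero, H.apply_one]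
      rfl
    · rw [hS 1 ⟨x, hx⟩, hT ⟨x, hx⟩ ⟨f x, hx⟩, unitInterval.symm_one, H.apply_zero, ← hfx]
      rfl
    · rw [hT ⟨x, hx⟩ ⟨y, hy⟩]
      exact congrArg Subtype.val (hψ ((φ ⟨x, hx⟩).1, ⟨y, hy⟩))

/-- Here `g` is `f` or its reversal, so that one statement serves both sides of a critical level. -/
theorem retractsFromAbove_of_isDeformationRetract {f g : X → ℝ} {a b c d ε : ℝ} (hε : 0 < ε)
    (hI : interlevel f a b = g ⁻¹' Set.Icc d (d + ε)) (hL : level f c = g ⁻¹' {d})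
    (h : IsDeformationRetract (Y := interlevel f a b) (Subtype.val ⁻¹' level f c)) :
    RetractsFromAbove g d := by
  classical
  rw [hI, hL] at h
  obtain ⟨ρ, hρ, ⟨H⟩⟩ := h
  let F : unitInterval × X → X := fun p ↦
    if hx : p.2 ∈ g ⁻¹' Set.Icc d (d + ε) then (H (p.1, ⟨p.2, hx⟩) : X) else p.2
  have hF : ∀ τ (x : g ⁻¹' Set.Icc d (d + ε)), F (τ, x) = H (τ, x) := by
    intro τ x
    simp only [F]
    rw [dif_pos x.2]
  refine ⟨ε, hε, F, ?_, ?_, ?_, ?_⟩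
  · rw [continuousOn_iff_continuous_domRestrict]
    have : Continuous fun p : (Set.univ ×ˢ (g ⁻¹' Set.Icc d (d + ε)) : Set (unitInterval × X)) ↦
        (H (p.1.1, ⟨p.1.2, p.2.2⟩) : X) :=
      continuous_subtype_val.comp (H.continuous.comp (by fun_prop))
    exact this.congr fun p ↦ (hF p.1.1 ⟨p.1.2, p.2.2⟩).symm
  · intro τ x hx
    rw [hF τ ⟨x, hx⟩]
    exact (H (τ, ⟨x, hx⟩)).2.1
  · intro x hx
    rw [hF 0 ⟨x, hx⟩, hF 1 ⟨x, hx⟩, H.apply_zero, H.apply_one]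
    exact ⟨rfl, hρ ⟨x, hx⟩⟩
  · intro τ x hx
    have hx' : x ∈ g ⁻¹' Set.Icc d (d + ε) := by
      simp only [Set.mem_preimage, hx, Set.mem_Icc]
      constructor <;> linarith
    rw [hF τ ⟨x, hx'⟩, H.eq_fst τ (x := ⟨x, hx'⟩) hx]
    rfl

theorem IsTame.isLocallyTame {f : X → ℝ} {N : ℕ} {c : Fin (N + 1) → ℝ} (h : IsTame f c) :
    IsLocallyTame f (Set.range c) where
  continuous := h.continuous
  compact := h.compact
  transport t ht := by
    obtain ⟨ε, hε, h⟩ := h.regular t ht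
    exact hasLocalTransport_of_fiberwiseHomotopyEquivalent hε h
  above := by
    rintro _ ⟨i, rfl⟩
    obtain ⟨ε, hε, h, -⟩ := h.critical i
    exact retractsFromAbove_of_isDeformationRetract hε
      (interlevel_of_le f (by linarith)) rfl h
  below := by
    rintro _ ⟨i, rfl⟩
    obtain ⟨ε, hε, -, h⟩ := h.critical i
    refine retractsFromAbove_of_isDeformationRetract hε ?_ ?_ h
    · rw [interlevel_of_le f (by linarith)]
      ext x
      simp only [Set.mem_preimage, Set.mem_Icc]
      constructor <;> rintro ⟨h₁, h₂⟩ <;> constructor <;> linarith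
    · ext x
      simp [level]

end LocalStructure

/-! ### Enlarging an interlevel set without meeting a critical value -/

section Extension

theorem interlevel_subset_interlevel {X : Type v} {f : X → ℝ} {a b d : ℝ} (hab : a ≤ b) (hbd : b ≤ d) :
    interlevel f a b ⊆ interlevel f a d := by
  rw [interlevel_of_le f hab, interlevel_of_le f (hab.trans hbd)]
  exact Set.preimage_mono (Set.Icc_subset_Icc_right hbd)

theorem interlevel_neg {X : Type v} (f : X → ℝ) (a b : ℝ) :
    interlevel (fun x ↦ -f x) a b = interlevel f (-b) (-a) := by
  ext x
  simp only [interlevel, Set.mem_preimage, Set.mem_uIcc]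
  constructor <;> rintro (⟨h₁, h₂⟩ | ⟨h₁, h₂⟩)
  · exact Or.inl ⟨by linarith, by linarith⟩
  · exact Or.inr ⟨by linarith, by linarith⟩
  · exact Or.inl ⟨by linarith, by linarith⟩
  · exact Or.inr ⟨by linarith, by linarith⟩

variable {X : Type v} [TopologicalSpace X] (κ : Type u) [Field κ] (r : ℕ) {f : X → ℝ}

theorem bijective_singHIncl_congr {A A' B B' : Set X} (eA : A = A') (eB : B = B') {h : A ⊆ B}
    {h' : A' ⊆ B'} (hb : Function.Bijective (singHIncl κ r h)) :
    Function.Bijective (singHIncl κ r h') := by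
  subst eA eB
  exact hb

theorem bijective_singHIncl_trans {A B D : Set X} (h : A ⊆ B) (h' : B ⊆ D)
    (hb : Function.Bijective (singHIncl κ r h)) (hb' : Function.Bijective (singHIncl κ r h')) :
    Function.Bijective (singHIncl κ r (h.trans h')) := by
  rw [singHIncl_comp κ r h h', LinearMap.coe_comp]
  exact hb'.comp hb

/-- Local transport between fibers lets one push the part above `b` down to the level of `b`. The
deformation has two stages: the fiberwise homotopy `S`, cut off below `b`, and then the transport
`T` along the base. -/
theorem bijective_singHIncl_of_local {t ε a b d : ℝ} (hf : Continuous f)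
    {S : unitInterval × X → X} {T : X × ℝ → X}
    (hS : ContinuousOn S (Set.univ ×ˢ (f ⁻¹' Set.Ioo (t - ε) (t + ε))))
    (hT : ContinuousOn T ((f ⁻¹' Set.Ioo (t - ε) (t + ε)) ×ˢ Set.Ioo (t - ε) (t + ε)))
    (hST : ∀ x ∈ f ⁻¹' Set.Ioo (t - ε) (t + ε), (∀ τ, f (S (τ, x)) = f x) ∧ S (0, x) = x ∧
      S (1, x) = T (x, f x) ∧ ∀ y ∈ Set.Ioo (t - ε) (t + ε), f (T (x, y)) = y)
    (hb : t - ε < b) (hd : d < t + ε) (hab : a ≤ b) (hbd : b ≤ d)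
    (h : interlevel f a b ⊆ interlevel f a d) : Function.Bijective (singHIncl κ r h) := by
  classical
  obtain ⟨b', hb', hb'b⟩ := exists_between hb
  -- A cut-off which vanishes at `b'` and equals `1` from `b` on: the fiberwise homotopy `S` is
  -- slowed down by it so that it extends by the constant homotopy below `b'`.
  let lam : ℝ → unitInterval := fun y ↦ Set.projIcc 0 1 zero_le_one ((y - b') / (b - b'))
  have hlam : Continuous lam := continuous_projIcc.comp (by fun_prop)
  have hlam0 : lam b' = 0 := by
    simp only [lam, sub_self, zero_div]
    exact Set.projIcc_left _
  have hlam1 : ∀ y, b ≤ y → lam y = 1 := by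
    intro y hy
    refine Set.projIcc_of_right_le _ ?_
    rw [le_div_iff₀ (by linarith)]
    linarith
  let F : unitInterval × X → X := fun p ↦ if f p.2 ≤ b' then p.2 else S (p.1 * lam (f p.2), p.2)
  have hF_low : ∀ τ x, f x ≤ b' → F (τ, x) = x := fun τ x hx ↦ if_pos hx
  have hF_high : ∀ τ x, b' ≤ f x → f x ≤ d → F (τ, x) = S (τ * lam (f x), x) := by
    intro τ x h₁ h₂
    rcases h₁.eq_or_lt with h₁ | h₁
    · rw [hF_low τ x h₁.ge, ← h₁, hlam0, mul_zero, (hST x ?_).2.1]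
      constructor <;> linarith
    · exact if_neg h₁.not_ge
  have hfF : ∀ τ x, f x ≤ d → f (F (τ, x)) = f x := by
    intro τ x hx
    rcases le_total (f x) b' with h₁ | h₁
    · rw [hF_low τ x h₁]
    · rw [hF_high τ x h₁ hx, (hST x _).1]
      constructor <;> linarith
  have hF0 : ∀ x, f x ≤ d → F (0, x) = x := by
    intro x hx
    rcases le_total (f x) b' with h₁ | h₁
    · rw [hF_low 0 x h₁]
    · rw [hF_high 0 x h₁ hx, zero_mul, (hST x _).2.1]
      constructor <;> linarith
  have hFc : ContinuousOn F (Set.univ ×ˢ (f ⁻¹' Set.Iic d)) := by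
    have h₁ : ContinuousOn F {p | f p.2 ≤ b'} :=
      continuousOn_snd.congr fun p hp ↦ hF_low p.1 p.2 hp
    have h₂ : ContinuousOn F {p | b' ≤ f p.2 ∧ f p.2 ≤ d} := by
      refine (hS.comp (f := fun p : unitInterval × X ↦ (p.1 * lam (f p.2), p.2)) (by fun_prop)
        fun p hp ↦ ?_).congr fun p hp ↦ hF_high p.1 p.2 hp.1 hp.2
      exact ⟨trivial, by linarith [hp.1], by linarith [hp.2]⟩
    refine (h₁.union_of_isClosed h₂ (isClosed_le (by fun_prop) (by fun_prop))
      (isClosed_Icc.preimage (by fun_prop : Continuous fun p : unitInterval × X ↦ f p.2))).mono ?_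
    rintro p ⟨-, hp⟩
    rcases le_total (f p.2) b' with h₁ | h₁
    · exact Or.inl h₁
    · exact Or.inr ⟨h₁, hp⟩
  -- After `F`, the part above `b` is transported down to the level of `b`.
  let G : unitInterval × X → X := fun p ↦
    if f p.2 ≤ b then F (1, p.2) else T (p.2, f p.2 + p.1 * (b - f p.2))
  have hG_low : ∀ τ x, f x ≤ b → G (τ, x) = F (1, x) := fun τ x hx ↦ if_pos hx
  have hF1 : ∀ x, b ≤ f x → f x ≤ d → F (1, x) = T (x, f x) := by
    intro x h₁ h₂
    rw [hF_high 1 x (by linarith) h₂, hlam1 _ h₁, mul_one, (hST x _).2.2.1]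
    constructor <;> linarith
  have hG_high : ∀ τ x, b ≤ f x → f x ≤ d → G (τ, x) = T (x, f x + τ * (b - f x)) := by
    intro τ x h₁ h₂
    rcases h₁.eq_or_lt with h₁ | h₁
    · rw [hG_low τ x h₁.ge, hF1 x h₁.le h₂, h₁, sub_self, mul_zero, add_zero]
    · exact if_neg h₁.not_ge
  have hG0 : ∀ x, f x ≤ d → G (0, x) = F (1, x) := by
    intro x hx
    rcases le_total (f x) b with h₁ | h₁
    · rw [hG_low 0 x h₁]
    · rw [hG_high 0 x h₁ hx, hF1 x h₁ hx]
      simp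
  have hmid : ∀ (τ : unitInterval) x, b ≤ f x →
      b ≤ f x + τ * (b - f x) ∧ f x + τ * (b - f x) ≤ f x := by
    intro τ x hx
    constructor <;> nlinarith [τ.2.1, τ.2.2]
  have hfG : ∀ τ x, b ≤ f x → f x ≤ d → f (G (τ, x)) = f x + τ * (b - f x) := by
    intro τ x h₁ h₂
    have := hmid τ x h₁
    rw [hG_high τ x h₁ h₂, (hST x _).2.2.2]
    · constructor <;> linarith
    · constructor <;> linarith
  have hGc : ContinuousOn G (Set.univ ×ˢ (f ⁻¹' Set.Iic d)) := by
    have h₁ : ContinuousOn G {p | f p.2 ≤ b} := by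
      refine (hFc.comp (f := fun p : unitInterval × X ↦ ((1 : unitInterval), p.2)) (by fun_prop)
        fun p hp ↦ ?_).congr fun p hp ↦ hG_low p.1 p.2 hp
      exact ⟨trivial, le_trans hp hbd⟩
    have h₂ : ContinuousOn G {p | b ≤ f p.2 ∧ f p.2 ≤ d} := by
      refine (hT.comp (f := fun p : unitInterval × X ↦ (p.2, f p.2 + p.1 * (b - f p.2)))
        (by fun_prop) fun p hp ↦ ?_).congr fun p hp ↦ hG_high p.1 p.2 hp.1 hp.2
      have := hmid p.1 p.2 hp.1
      have := hp.1
      have := hp.2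
      refine ⟨⟨?_, ?_⟩, ?_, ?_⟩ <;> simp only <;> linarith
    refine (h₁.union_of_isClosed h₂ (isClosed_le (by fun_prop) (by fun_prop))
      (isClosed_Icc.preimage (by fun_prop : Continuous fun p : unitInterval × X ↦ f p.2))).mono ?_
    rintro p ⟨-, hp⟩
    rcases le_total (f p.2) b with h₁ | h₁
    · exact Or.inl h₁
    · exact Or.inr ⟨h₁, hp⟩
  have key : ∀ e, b ≤ e → e ≤ d →
      HomotopicOn (interlevel f a e) (interlevel f a e) id fun x ↦ G (1, x) := by
    intro e hbe hed
    rw [interlevel_of_le f (hab.trans hbe)]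
    have hsub : (Set.univ ×ˢ (f ⁻¹' Set.Icc a e) : Set (unitInterval × X)) ⊆
        Set.univ ×ˢ (f ⁻¹' Set.Iic d) :=
      Set.prod_mono_right (Set.preimage_mono fun y hy ↦ hy.2.trans hed)
    have hFm : ∀ τ, ∀ x ∈ f ⁻¹' Set.Icc a e, F (τ, x) ∈ f ⁻¹' Set.Icc a e := by
      intro τ x hx
      rw [Set.mem_preimage, hfF τ x (hx.2.trans hed)]
      exact hx
    have hGm : ∀ τ, ∀ x ∈ f ⁻¹' Set.Icc a e, G (τ, x) ∈ f ⁻¹' Set.Icc a e := by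
      intro τ x hx
      rcases le_total (f x) b with h₁ | h₁
      · rw [hG_low τ x h₁]
        exact hFm 1 x hx
      · rw [Set.mem_preimage, hfG τ x h₁ (hx.2.trans hed)]
        have := hmid τ x h₁
        exact ⟨by linarith, this.2.trans hx.2⟩
    refine ((HomotopicOn.of_continuousOn F (hFc.mono hsub) hFm).congr
      (fun x hx ↦ hF0 x (hx.2.trans hed)) fun x hx ↦ rfl).trans
      ((HomotopicOn.of_continuousOn G (hGc.mono hsub) hGm).congr
        (fun x hx ↦ hG0 x (hx.2.trans hed)) fun x hx ↦ rfl)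
  refine bijective_singHIncl_of_homotopicOn κ r h subset_rfl
    (bijective_singHIncl_of_eq κ r rfl _) (key d hbd le_rfl) (key b le_rfl hbd) ?_ h
  intro x hx
  rw [interlevel_of_le f (hab.trans hbd)] at hx
  rw [interlevel_of_le f hab]
  change G (1, x) ∈ _
  rcases le_total (f x) b with h₁ | h₁
  · rw [hG_low 1 x h₁, Set.mem_preimage, hfF 1 x hx.2]
    exact ⟨hx.1, h₁⟩
  · rw [Set.mem_preimage, hfG 1 x h₁ hx.2]
    simpa using hab

/-- A relation on the line that is transitive along increasing triples and holds locally holds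
between the ends of any interval. -/
theorem rel_of_locally {P : ℝ → ℝ → Prop} {b d : ℝ} (hbd : b ≤ d)
    (hP : ∀ x y z, x ≤ y → y ≤ z → P x y → P y z → P x z)
    (hloc : ∀ t ∈ Set.Icc b d, ∃ ε > 0, ∀ x y, t - ε < x → x ≤ y → y < t + ε → P x y) :
    P b d := by
  choose! ε hε h using hloc
  obtain ⟨s, hs0, hsm, ⟨m, hm⟩, hs⟩ := exists_monotone_Icc_subset_open_cover_Icc hbd
    (c := fun t : Set.Icc b d ↦ {y | (y : ℝ) ∈ Set.Ioo (t - ε t) (t + ε t)})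
    (fun t ↦ isOpen_Ioo.preimage continuous_subtype_val) (fun t _ ↦ Set.mem_iUnion.2
      ⟨t, by have := hε t t.2; constructor <;> linarith⟩)
  have hstep : ∀ n, P (s n) (s (n + 1)) := by
    intro n
    obtain ⟨t, ht⟩ := hs n
    have hle := hsm (Nat.le_succ n)
    exact h t t.2 _ _ (ht ⟨le_rfl, hle⟩).1 hle (ht ⟨hle, le_rfl⟩).2
  have hind : ∀ n, P b (s (n + 1)) := by
    intro n
    induction n with
    | zero => simpa [hs0] using hstep 0
    | succ n ih => exact hP _ _ _ (s (n + 1)).2.1 (hsm (Nat.le_succ _)) ih (hstep (n + 1))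
  have := hind m
  rwa [hm (m + 1) (Nat.le_succ m)] at this

theorem IsLocallyTame.bijective_of_disjoint_Icc {C : Set ℝ} (hf : IsLocallyTame f C) {a b d : ℝ}
    (hab : a ≤ b) (hbd : b ≤ d) (hC : ∀ t ∈ C, ¬ (b ≤ t ∧ t ≤ d))
    (h : interlevel f a b ⊆ interlevel f a d) : Function.Bijective (singHIncl κ r h) := by
  refine rel_of_locally (P := fun x y ↦ a ≤ x → ∀ h : interlevel f a x ⊆ interlevel f a y,
    Function.Bijective (singHIncl κ r h)) hbd ?_ ?_ hab h
  · intro x y z hxy hyz h₁ h₂ hax h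
    have e₁ := interlevel_subset_interlevel (f := f) hax hxy
    have e₂ := interlevel_subset_interlevel (f := f) (hax.trans hxy) hyz
    exact bijective_singHIncl_trans κ r e₁ e₂ (h₁ hax e₁) (h₂ (hax.trans hxy) e₂)
  · intro t ht
    obtain ⟨ε, hε, S, T, hS, hT, hST⟩ := hf.transport t fun htC ↦ hC t htC ht
    exact ⟨ε, hε, fun x y hx hxy hy hax h ↦
      bijective_singHIncl_of_local κ r hf.continuous hS hT hST hx hy hax hxy h⟩

/-- The case in which the old end `b` may be critical. The homotopy `F` provided by tameness may
leave the given interval `[b, d]`, but it fixes the level of `b`, so that by compactness of `X` it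
keeps a thinner slice `[b, δ]` over `[b, d]`; and the slices over `[b, δ]` and `[b, d]` have the
same homology because all values in `[δ, d]` are regular. -/
theorem IsLocallyTame.bijective_of_disjoint_Ioc {C : Set ℝ} (hf : IsLocallyTame f C) {a b d : ℝ}
    (hab : a ≤ b) (hbd : b ≤ d) (hC : ∀ t ∈ C, ¬ (b < t ∧ t ≤ d))
    (h : interlevel f a b ⊆ interlevel f a d) : Function.Bijective (singHIncl κ r h) := by
  classical
  by_cases hbC : b ∈ C
  swap
  · refine hf.bijective_of_disjoint_Icc κ r hab hbd (fun t ht ⟨h₁, h₂⟩ ↦ ?_) h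
    exact hC t ht ⟨h₁.lt_of_ne fun e ↦ hbC (e ▸ ht), h₂⟩
  rcases hbd.eq_or_lt with rfl | hbd'
  · exact bijective_singHIncl_of_eq κ r rfl h
  have := hf.compact
  have hcont := hf.continuous
  obtain ⟨ε, hε, F, hFc, hFm, hF01, hFix⟩ := hf.above b hbC
  have hslice : IsClosed (f ⁻¹' Set.Icc b (b + ε)) := isClosed_Icc.preimage hcont
  -- The pairs `(τ, x)` with `F (τ, x)` at height at least `d` form a compact set, on which `f x` is
  -- bounded below by some number greater than `b` because `F` fixes the level of `b`.
  obtain ⟨δ, hbδ, hδε, hδd, hδ⟩ : ∃ δ > b, δ ≤ b + ε ∧ δ ≤ d ∧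
      ∀ τ x, b ≤ f x → f x ≤ δ → f (F (τ, x)) ≤ d := by
    let K : Set (unitInterval × X) :=
      (Set.univ ×ˢ (f ⁻¹' Set.Icc b (b + ε))) ∩ F ⁻¹' (f ⁻¹' Set.Ici d)
    have hK : IsCompact K :=
      (hFc.preimage_isClosed_of_isClosed (isClosed_univ.prod hslice)
        (isClosed_Ici.preimage hcont)).isCompact
    rcases K.eq_empty_or_nonempty with hKe | hKn
    · refine ⟨min (b + ε) d, lt_min (by linarith) hbd', min_le_left _ _, min_le_right _ _,
        fun τ x h₁ h₂ ↦ ?_⟩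
      by_contra! h₃
      have : (τ, x) ∈ K := ⟨⟨trivial, h₁, h₂.trans (min_le_left _ _)⟩, h₃.le⟩
      rw [hKe] at this
      exact this
    · obtain ⟨⟨τ₀, x₀⟩, hp, hmin⟩ := hK.exists_isMinOn hKn
        (f := fun p : unitInterval × X ↦ f p.2) (by fun_prop)
      have hx₀ : b < f x₀ := by
        refine hp.1.2.1.lt_of_ne fun e ↦ ?_
        have h₁ : d ≤ f (F (τ₀, x₀)) := hp.2
        rw [hFix τ₀ x₀ e.symm, ← e] at h₁
        linarith
      obtain ⟨δ, h₁, h₂⟩ := exists_between (lt_min (lt_min hx₀ (by linarith : b < b + ε)) hbd')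
      rw [lt_min_iff, lt_min_iff] at h₂
      refine ⟨δ, h₁, h₂.1.2.le, h₂.2.le, fun τ x h₃ h₄ ↦ ?_⟩
      by_contra! h₅
      have h₆ : f x₀ ≤ f x := hmin (a := (τ, x))
        ⟨⟨trivial, h₃, h₄.trans h₂.1.2.le⟩, h₅.le⟩
      linarith [h₂.1.1]
  let E : unitInterval × X → X := fun p ↦ if f p.2 ≤ b then p.2 else F p
  have hE_low : ∀ τ x, f x ≤ b → E (τ, x) = x := fun τ x hx ↦ if_pos hx
  have hE_high : ∀ τ x, b ≤ f x → E (τ, x) = F (τ, x) := by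
    intro τ x h₁
    rcases h₁.eq_or_lt with h₁ | h₁
    · rw [hE_low τ x h₁.ge, hFix τ x h₁.symm]
    · exact if_neg h₁.not_ge
  have hEc : ContinuousOn E (Set.univ ×ˢ (f ⁻¹' Set.Iic δ)) := by
    have h₁ : ContinuousOn E {p | f p.2 ≤ b} :=
      continuousOn_snd.congr fun p hp ↦ hE_low p.1 p.2 hp
    have h₂ : ContinuousOn E (Set.univ ×ˢ (f ⁻¹' Set.Icc b (b + ε))) :=
      hFc.congr fun p hp ↦ hE_high p.1 p.2 hp.2.1
    refine (h₁.union_of_isClosed h₂ (isClosed_le (by fun_prop) (by fun_prop))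
      (isClosed_univ.prod hslice)).mono ?_
    rintro p ⟨-, hp⟩
    rcases le_total (f p.2) b with h₁ | h₁
    · exact Or.inl h₁
    · exact Or.inr ⟨trivial, h₁, le_trans hp hδε⟩
  have hE0 : ∀ x, f x ≤ δ → E (0, x) = x := by
    intro x hx
    rcases le_total (f x) b with h₁ | h₁
    · exact hE_low 0 x h₁
    · rw [hE_high 0 x h₁, (hF01 x ⟨h₁, hx.trans hδε⟩).1]
  have hsub : ∀ y ≤ δ, (Set.univ ×ˢ (f ⁻¹' Set.Icc a y) : Set (unitInterval × X)) ⊆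
      Set.univ ×ˢ (f ⁻¹' Set.Iic δ) := fun y hy ↦
    Set.prod_mono_right (Set.preimage_mono fun z hz ↦ hz.2.trans hy)
  have hδC : Function.Bijective (singHIncl κ r
      (interlevel_subset_interlevel (f := f) (hab.trans hbδ.le) hδd)) :=
    hf.bijective_of_disjoint_Icc κ r (hab.trans hbδ.le) hδd
      (fun t ht ⟨h₁, h₂⟩ ↦ hC t ht ⟨hbδ.trans_le h₁, h₂⟩) _
  refine bijective_singHIncl_of_homotopicOn κ r (interlevel_subset_interlevel hab hbδ.le) _ hδC
    (k := fun x ↦ E (1, x)) ?_ ?_ ?_ h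
  · rw [interlevel_of_le f (hab.trans hbδ.le), interlevel_of_le f (hab.trans hbd)]
    refine (HomotopicOn.of_continuousOn E (hEc.mono (hsub δ le_rfl)) ?_).congr
      (fun x hx ↦ hE0 x hx.2) fun x hx ↦ rfl
    intro τ x hx
    rcases le_total (f x) b with h₁ | h₁
    · rw [hE_low τ x h₁]
      exact ⟨hx.1, h₁.trans hbd⟩
    · rw [hE_high τ x h₁]
      exact ⟨hab.trans (hFm τ x ⟨h₁, hx.2.trans hδε⟩), hδ τ x h₁ hx.2⟩
  · rw [interlevel_of_le f hab]
    refine (HomotopicOn.of_continuousOn E (hEc.mono (hsub b hbδ.le)) ?_).congr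
      (fun x hx ↦ hE0 x (hx.2.trans hbδ.le)) fun x hx ↦ rfl
    intro τ x hx
    rw [hE_low τ x hx.2]
    exact hx
  · intro x hx
    rw [interlevel_of_le f (hab.trans hbδ.le)] at hx
    rw [interlevel_of_le f hab]
    rcases le_total (f x) b with h₁ | h₁
    · simp only [hE_low 1 x h₁]
      exact ⟨hx.1, h₁⟩
    · simp only [hE_high 1 x h₁, Set.mem_preimage, (hF01 x ⟨h₁, hx.2.trans hδε⟩).2]
      exact ⟨hab, le_rfl⟩

/-- The mirror image of `IsLocallyTame.bijective_of_disjoint_Ioc`. -/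
theorem IsLocallyTame.bijective_of_disjoint_Ico {C : Set ℝ} (hf : IsLocallyTame f C) {a b d : ℝ}
    (hab : a ≤ b) (hbd : b ≤ d) (hC : ∀ t ∈ C, ¬ (a ≤ t ∧ t < b))
    (h : interlevel f b d ⊆ interlevel f a d) : Function.Bijective (singHIncl κ r h) := by
  have key := hf.neg.bijective_of_disjoint_Ioc κ r (neg_le_neg hbd) (neg_le_neg hab)
    fun t ht ⟨h₁, h₂⟩ ↦ hC (-t) ht ⟨by linarith, by linarith⟩
  have e₁ : interlevel (fun x ↦ -f x) (-d) (-b) = interlevel f b d := by simp [interlevel_neg]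
  have e₂ : interlevel (fun x ↦ -f x) (-d) (-a) = interlevel f a d := by simp [interlevel_neg]
  exact bijective_singHIncl_congr κ r e₁ e₂ (key (e₁.trans_subset (h.trans e₂.superset)))

end Extension

/-! ### Comparison of the kernels -/

section Kernels

variable {X : Type v} [TopologicalSpace X] (κ : Type u) [Field κ] (r : ℕ) {f : X → ℝ}

theorem ker_singHIncl_eq_of_injective {A B D : Set X} (h : A ⊆ B) (h' : B ⊆ D) (h'' : A ⊆ D)
    (hi : Function.Injective (singHIncl κ r h')) :
    LinearMap.ker (singHIncl κ r h'') = LinearMap.ker (singHIncl κ r h) := by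
  rw [singHIncl_comp κ r h h']
  exact LinearMap.ker_comp_of_ker_eq_bot _ (LinearMap.ker_eq_bot.2 hi)

theorem upKer_self (f : X → ℝ) (s : ℝ) : upKer κ r f s s = ⊥ :=
  LinearMap.ker_eq_bot.2 (bijective_singHIncl_of_eq κ r (by simp [level, interlevel]) _).1

theorem downKer_self (f : X → ℝ) (s : ℝ) : downKer κ r f s s = ⊥ :=
  LinearMap.ker_eq_bot.2 (bijective_singHIncl_of_eq κ r (by simp [level, interlevel]) _).1

theorem interlevel_subset_interlevel' {X : Type v} {f : X → ℝ} {a b d : ℝ} (hab : a ≤ b)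
    (hbd : b ≤ d) : interlevel f b d ⊆ interlevel f a d := by
  rw [interlevel_of_le f hbd, interlevel_of_le f (hab.trans hbd)]
  exact Set.preimage_mono (Set.Icc_subset_Icc_left hab)

theorem IsLocallyTame.upKer_eq {C : Set ℝ} (hf : IsLocallyTame f C) {s t t' : ℝ} (hs : s ≤ t')
    (ht : t' ≤ t) (hC : ∀ x ∈ C, ¬ (t' < x ∧ x ≤ t)) : upKer κ r f s t = upKer κ r f s t' :=
  ker_singHIncl_eq_of_injective κ r _ (interlevel_subset_interlevel hs ht) _
    (hf.bijective_of_disjoint_Ioc κ r hs ht hC _).1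

theorem IsLocallyTame.downKer_eq {C : Set ℝ} (hf : IsLocallyTame f C) {s u u' : ℝ} (hs : u' ≤ s)
    (hu : u ≤ u') (hC : ∀ x ∈ C, ¬ (u ≤ x ∧ x < u')) : downKer κ r f s u = downKer κ r f s u' :=
  ker_singHIncl_eq_of_injective κ r _ (interlevel_subset_interlevel' hu hs) _
    (hf.bijective_of_disjoint_Ico κ r hu hs hC _).1

/-- Levels `s ≤ m` with only regular values in between have the same homology, by way of the
homology of the slice between them, and this identification respects the kernels. -/
theorem IsLocallyTame.exists_equiv_of_le {C : Set ℝ} (hf : IsLocallyTame f C) {s m : ℝ}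
    (hsm : s ≤ m) (hC : ∀ x ∈ C, ¬ (s ≤ x ∧ x ≤ m)) :
    ∃ Φ : singH κ r (level f s) ≃ₗ[κ] singH κ r (level f m),
      (∀ t, m ≤ t → ∀ x, x ∈ upKer κ r f s t ↔ Φ x ∈ upKer κ r f m t) ∧
      ∀ u, u ≤ s → ∀ x, x ∈ downKer κ r f s u ↔ Φ x ∈ downKer κ r f m u := by
  have hup : ∀ a, a ≤ s → ∀ h, Function.Bijective
      (singHIncl κ r (h : interlevel f a s ⊆ interlevel f a m)) := fun a ha h ↦
    hf.bijective_of_disjoint_Ioc κ r ha hsm (fun x hx h ↦ hC x hx ⟨h.1.le, h.2⟩) h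
  have hdown : ∀ t, m ≤ t → ∀ h, Function.Bijective
      (singHIncl κ r (h : interlevel f m t ⊆ interlevel f s t)) := fun t ht h ↦
    hf.bijective_of_disjoint_Ico κ r hsm ht (fun x hx h ↦ hC x hx ⟨h.1, h.2.le⟩) h
  have hα : Function.Bijective (singHIncl κ r (level_subset_left f s m)) :=
    bijective_singHIncl_congr κ r (by simp [level, interlevel]) rfl
      (hup s le_rfl (interlevel_subset_interlevel le_rfl hsm))
  have hβ : Function.Bijective (singHIncl κ r (level_subset_right f s m)) :=
    bijective_singHIncl_congr κ r (by simp [level, interlevel]) rfl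
      (hdown m le_rfl (interlevel_subset_interlevel' hsm le_rfl))
  let Φ := (LinearEquiv.ofBijective _ hα).trans (LinearEquiv.ofBijective _ hβ).symm
  have hΦ : ∀ x, singHIncl κ r (level_subset_right f s m) (Φ x) =
      singHIncl κ r (level_subset_left f s m) x := fun x ↦
    (LinearEquiv.ofBijective _ hβ).apply_symm_apply _
  -- In any set containing the slice the classes `x` and `Φ x` agree.
  have key : ∀ {D : Set X} (h : interlevel f s m ⊆ D) x,
      x ∈ LinearMap.ker (singHIncl κ r ((level_subset_left f s m).trans h)) ↔
      Φ x ∈ LinearMap.ker (singHIncl κ r ((level_subset_right f s m).trans h)) := by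
    intro D h x
    rw [singHIncl_comp κ r (level_subset_left f s m) h,
      singHIncl_comp κ r (level_subset_right f s m) h, LinearMap.mem_ker, LinearMap.mem_ker,
      LinearMap.comp_apply, LinearMap.comp_apply, hΦ]
  refine ⟨Φ, fun t ht x ↦ ?_, fun u hu x ↦ ?_⟩
  · have e := interlevel_subset_interlevel (f := f) hsm ht
    have e' := interlevel_subset_interlevel' (f := f) hsm ht
    refine (key e x).trans ?_
    rw [ker_singHIncl_eq_of_injective κ r (level_subset_left f m t) e' _ (hdown t ht e').1]
    rfl
  · have e := interlevel_subset_interlevel' (f := f) hu hsm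
    have e' := interlevel_subset_interlevel (f := f) hu hsm
    refine Iff.trans ?_ (key e x)
    rw [ker_singHIncl_eq_of_injective κ r (level_subset_right f u s) e' _ (hup u hu e').1]
    rfl

theorem IsLocallyTame.exists_equiv {C : Set ℝ} (hf : IsLocallyTame f C) {s m : ℝ}
    (hC : ∀ x ∈ C, x ∉ Set.uIcc s m) :
    ∃ Φ : singH κ r (level f s) ≃ₗ[κ] singH κ r (level f m),
      (∀ t, s ≤ t → m ≤ t → upKer κ r f s t = (upKer κ r f m t).comap Φ.toLinearMap) ∧
      ∀ u, u ≤ s → u ≤ m → downKer κ r f s u = (downKer κ r f m u).comap Φ.toLinearMap := by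
  rcases le_total s m with h | h
  · rw [Set.uIcc_of_le h] at hC
    obtain ⟨Φ, h₁, h₂⟩ := hf.exists_equiv_of_le κ r h hC
    exact ⟨Φ, fun t _ ht ↦ Submodule.ext (h₁ t ht), fun u hu _ ↦ Submodule.ext (h₂ u hu)⟩
  · rw [Set.uIcc_of_ge h] at hC
    obtain ⟨Φ, h₁, h₂⟩ := hf.exists_equiv_of_le κ r h hC
    exact ⟨Φ.symm, fun t ht _ ↦ Submodule.ext fun x ↦ by simpa using (h₁ t ht (Φ.symm x)).symm,
      fun u _ hu ↦ Submodule.ext fun x ↦ by simpa using (h₂ u hu (Φ.symm x)).symm⟩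

end Kernels

/-! ### Critical values and their indices -/

section Indices

variable {N : ℕ} {c : Fin (N + 1) → ℝ}

theorem exists_isFloorIndex {t : ℝ} (h : c 0 ≤ t) : ∃ j, IsFloorIndex c t j := by
  classical
  obtain ⟨j, hj, hmax⟩ := (Finset.univ.filter fun l ↦ c l ≤ t).exists_max_image id
    ⟨0, by simpa using h⟩
  refine ⟨j, by simpa using hj, fun l hl ↦ ?_⟩
  by_contra! hlt
  exact (hmax l (by simpa using hlt)).not_gt hl

theorem exists_isCeilIndex {u : ℝ} (h : u ≤ c (Fin.last N)) : ∃ k, IsCeilIndex c u k := by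
  classical
  obtain ⟨k, hk, hmin⟩ := (Finset.univ.filter fun l ↦ u ≤ c l).exists_min_image id
    ⟨Fin.last N, by simpa using h⟩
  refine ⟨k, by simpa using hk, fun l hl ↦ ?_⟩
  by_contra! hlt
  exact (hmin l (by simpa using hlt)).not_gt hl

theorem exists_castSucc_le_lt_succ {s : ℝ} (h₀ : c 0 ≤ s) (h₁ : s < c (Fin.last N)) :
    ∃ i : Fin N, c i.castSucc ≤ s ∧ s < c i.succ := by
  obtain ⟨i, hi, hlt⟩ := exists_isFloorIndex h₀
  induction i using Fin.lastCases with
  | last => exact absurd h₁ hi.not_gt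
  | cast i => exact ⟨i, hi, hlt _ i.castSucc_lt_succ⟩

theorem exists_isRepresentative {s : ℝ} (h₀ : c 0 ≤ s) (h₁ : s ≤ c (Fin.last N)) :
    ∃ σ, IsRepresentative c s σ := by
  rcases h₁.eq_or_lt with rfl | h₁
  · exact ⟨_, Or.inl ⟨_, rfl, rfl⟩⟩
  obtain ⟨i, hi, hlt⟩ := exists_castSucc_le_lt_succ h₀ h₁
  rcases hi.eq_or_lt with rfl | hi
  · exact ⟨_, Or.inl ⟨_, rfl, rfl⟩⟩
  · exact ⟨_, Or.inr ⟨i, hi, hlt, rfl⟩⟩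

theorem castSucc_lt_midValue (hc : StrictMono c) (i : Fin N) : c i.castSucc < midValue c i := by
  have := hc i.castSucc_lt_succ
  unfold midValue
  linarith

theorem midValue_lt_succ (hc : StrictMono c) (i : Fin N) : midValue c i < c i.succ := by
  have := hc i.castSucc_lt_succ
  unfold midValue
  linarith

theorem le_castSucc_or_succ_le (hc : StrictMono c) (i : Fin N) (l : Fin (N + 1)) :
    c l ≤ c i.castSucc ∨ c i.succ ≤ c l := by
  rcases le_or_gt l i.castSucc with h | h
  · exact Or.inl (hc.monotone h)
  · exact Or.inr (hc.monotone (Fin.castSucc_lt_iff_succ_le.1 h))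

theorem IsFloorIndex.le_of_le {t : ℝ} {j l : Fin (N + 1)} (hc : StrictMono c)
    (h : IsFloorIndex c t j) (hl : c l ≤ t) : c l ≤ c j := by
  by_contra! hlt
  exact (h.2 l (hc.lt_iff_lt.1 hlt)).not_ge hl

theorem IsCeilIndex.le_of_le {u : ℝ} {k l : Fin (N + 1)} (hc : StrictMono c)
    (h : IsCeilIndex c u k) (hl : u ≤ c l) : c k ≤ c l := by
  by_contra! hlt
  exact (h.2 l (hc.lt_iff_lt.1 hlt)).not_ge hl

end Indices

/-! ### Passage to representative values -/

section Tame

variable {X : Type v} [TopologicalSpace X] (κ : Type u) [Field κ] (r : ℕ) {f : X → ℝ}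
  {N : ℕ} {c : Fin (N + 1) → ℝ}

/-- All the comparisons at once: a single isomorphism from the homology of the level of `s` to that
of its representative `σ` matches both kernels, unless these vanish. -/
theorem IsTame.exists_equiv_representative (hf : IsTame f c) {u s t σ : ℝ} {k j : Fin (N + 1)}
    (hus : u ≤ s) (hst : s ≤ t) (hk : IsCeilIndex c u k) (hσ : IsRepresentative c s σ)
    (hj : IsFloorIndex c t j) :
    ∃ Φ : singH κ r (level f s) ≃ₗ[κ] singH κ r (level f σ),
      (σ ≤ c j → upKer κ r f s t = (upKer κ r f σ (c j)).comap Φ.toLinearMap) ∧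
      (c j < σ → upKer κ r f s t = ⊥) ∧
      (c k ≤ σ → downKer κ r f s u = (downKer κ r f σ (c k)).comap Φ.toLinearMap) ∧
      (σ < c k → downKer κ r f s u = ⊥) := by
  have hc := hf.strictMono
  have hl := hf.isLocallyTame
  have hjt : ∀ x ∈ Set.range c, ¬ (c j < x ∧ x ≤ t) := by
    rintro _ ⟨l, rfl⟩ ⟨h₁, h₂⟩
    exact h₁.not_ge (hj.le_of_le hc h₂)
  have huk : ∀ x ∈ Set.range c, ¬ (u ≤ x ∧ x < c k) := by
    rintro _ ⟨l, rfl⟩ ⟨h₁, h₂⟩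
    exact h₂.not_ge (hk.le_of_le hc h₁)
  rcases hσ with ⟨i, rfl, rfl⟩ | ⟨i, his, hsi, rfl⟩
  · refine ⟨LinearEquiv.refl κ _, fun h ↦ ?_, fun h ↦ ?_, fun h ↦ ?_, fun h ↦ ?_⟩
    · rw [hl.upKer_eq κ r h hj.1 hjt, LinearEquiv.refl_toLinearMap, Submodule.comap_id]
    · exact absurd (hj.le_of_le hc hst) h.not_ge
    · rw [hl.downKer_eq κ r h hk.1 huk, LinearEquiv.refl_toLinearMap, Submodule.comap_id]
    · exact absurd (hk.le_of_le hc hus) h.not_ge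
  · have hm := castSucc_lt_midValue hc i
    have hm' := midValue_lt_succ hc i
    obtain ⟨Φ, hup, hdown⟩ := hl.exists_equiv κ r (s := s) (m := midValue c i) (by
      rintro _ ⟨l, rfl⟩ h
      rw [Set.mem_uIcc] at h
      rcases le_castSucc_or_succ_le hc i l with h' | h' <;> rcases h with h | h <;> linarith)
    refine ⟨Φ, fun h ↦ ?_, fun h ↦ ?_, fun h ↦ ?_, fun h ↦ ?_⟩
    · have hij : c i.succ ≤ c j := (le_castSucc_or_succ_le hc i j).resolve_left (by linarith)
      rw [hl.upKer_eq κ r (hsi.le.trans hij) hj.1 hjt]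
      exact hup _ (by linarith) h
    · have hij : c j ≤ c i.castSucc := (le_castSucc_or_succ_le hc i j).resolve_right (by linarith)
      rw [hl.upKer_eq κ r le_rfl hst fun x hx h ↦ hjt x hx ⟨by linarith, h.2⟩, upKer_self]
    · have hki : c k ≤ c i.castSucc := (le_castSucc_or_succ_le hc i k).resolve_right (by linarith)
      rw [hl.downKer_eq κ r (hki.trans his.le) hk.1 huk]
      exact hdown _ (by linarith) h
    · have hik : c i.succ ≤ c k := (le_castSucc_or_succ_le hc i k).resolve_left (by linarith)
      rw [hl.downKer_eq κ r le_rfl hus fun x hx h ↦ huk x hx ⟨h.1, by linarith⟩, downKer_self]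

theorem nonempty_equiv_of_eq_comap {M M' : Type*} [AddCommGroup M] [Module κ M] [AddCommGroup M']
    [Module κ M'] (Φ : M ≃ₗ[κ] M') {p : Submodule κ M} {q : Submodule κ M'}
    (h : p = q.comap Φ.toLinearMap) : Nonempty (p ≃ₗ[κ] q) := by
  subst h
  exact ⟨Φ.ofSubmodule' q⟩

end Tame

theorem mainTheorem8 {κ : Type u} [Field κ] {X : Type v} [TopologicalSpace X]
    (f : X → ℝ) {N : ℕ} (c : Fin (N + 1) → ℝ) (hf : IsTame f c) (r : ℕ) :
    -- the isomorphisms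
    (∀ u s t : ℝ, c 0 ≤ u → u < s → s < t → t ≤ c (Fin.last N) →
      (∃ (k : Fin (N + 1)) (i : Fin N) (j : Fin (N + 1)), IsCeilIndex c u k ∧
        (c i.castSucc ≤ s ∧ s < c i.succ) ∧ IsFloorIndex c t j) ∧
      ∀ (k : Fin (N + 1)) (i : Fin N) (j : Fin (N + 1)), IsCeilIndex c u k →
        (c i.castSucc ≤ s ∧ s < c i.succ) → IsFloorIndex c t j →
        -- the homology of the level
        ((s = c i.castSucc →
            Nonempty (singH κ r (level f s) ≃ₗ[κ] singH κ r (level f (c i.castSucc)))) ∧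
          (c i.castSucc < s →
            Nonempty (singH κ r (level f s) ≃ₗ[κ] singH κ r (level f (midValue c i))))) ∧
        -- the kernel to the right
        ((s = c i.castSucc →
            Nonempty (upKer κ r f s t ≃ₗ[κ] upKer κ r f (c i.castSucc) (c j))) ∧
          (c i.castSucc < s → c i.succ ≤ t →
            Nonempty (upKer κ r f s t ≃ₗ[κ] upKer κ r f (midValue c i) (c j))) ∧
          (c i.castSucc < s → t < c i.succ → upKer κ r f s t = ⊥)) ∧
        -- the kernel to the left
        ((s = c i.castSucc →
            Nonempty (downKer κ r f s u ≃ₗ[κ] downKer κ r f (c i.castSucc) (c k))) ∧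
          (c i.castSucc < s → u ≤ c i.castSucc →
            Nonempty (downKer κ r f s u ≃ₗ[κ] downKer κ r f (midValue c i) (c k))) ∧
          (c i.castSucc < u → downKer κ r f s u = ⊥)) ∧
        -- the intersection of the two kernels
        ((s = c i.castSucc →
            Nonempty (↥(upKer κ r f s t ⊓ downKer κ r f s u) ≃ₗ[κ]
              ↥(upKer κ r f (c i.castSucc) (c j) ⊓ downKer κ r f (c i.castSucc) (c k)))) ∧
          (c i.castSucc < s → u ≤ c i.castSucc → c i.succ ≤ t →
            Nonempty (↥(upKer κ r f s t ⊓ downKer κ r f s u) ≃ₗ[κ]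
              ↥(upKer κ r f (midValue c i) (c j) ⊓ downKer κ r f (midValue c i) (c k)))) ∧
          (c i.castSucc < s → ¬ (u ≤ c i.castSucc ∧ c i.succ ≤ t) →
            upKer κ r f s t ⊓ downKer κ r f s u = ⊥))) ∧
    -- the relevant level persistence numbers are determined by finitely many of them
    (∀ u s t : ℝ, c 0 ≤ u → u ≤ s → s ≤ t → t ≤ c (Fin.last N) →
      (∃ (k j : Fin (N + 1)) (σ : ℝ),
        IsCeilIndex c u k ∧ IsRepresentative c s σ ∧ IsFloorIndex c t j) ∧
      ∀ (k j : Fin (N + 1)) (σ : ℝ),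
        IsCeilIndex c u k → IsRepresentative c s σ → IsFloorIndex c t j →
        persL κ r f s = persL κ r f σ ∧
        (σ ≤ c j → persUp κ r f s t = persUp κ r f σ (c j)) ∧
        (c j < σ → persUp κ r f s t = 0) ∧
        (c k ≤ σ → persDown κ r f s u = persDown κ r f σ (c k)) ∧
        (σ < c k → persDown κ r f s u = 0) ∧
        (c k ≤ σ → σ ≤ c j → persE κ r f s t u = persE κ r f σ (c j) (c k)) ∧
        (σ < c k ∨ c j < σ → persE κ r f s t u = 0)) := by
  have hc := hf.strictMono
  refine ⟨fun u s t h0u hus hst htN ↦ ⟨?_, ?_⟩, fun u s t h0u hus hst htN ↦ ⟨?_, ?_⟩⟩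
  · obtain ⟨k, hk⟩ := exists_isCeilIndex (hus.le.trans (hst.le.trans htN))
    obtain ⟨i, hi⟩ := exists_castSucc_le_lt_succ (h0u.trans hus.le) (hst.trans_le htN)
    obtain ⟨j, hj⟩ := exists_isFloorIndex (h0u.trans (hus.le.trans hst.le))
    exact ⟨k, i, j, hk, hi, hj⟩
  · intro k i j hk ⟨his, hsi⟩ hj
    have hm := castSucc_lt_midValue hc i
    have hm' := midValue_lt_succ hc i
    have hjt := hj.1
    have huk := hk.1
    rcases his.eq_or_lt with his | his
    · obtain ⟨Φ, hup, -, hdown, -⟩ := hf.exists_equiv_representative κ r hus.le hst.le hk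
        (Or.inl ⟨i.castSucc, his.symm, rfl⟩) hj
      have hup := hup (hj.le_of_le hc (by linarith))
      have hdown := hdown (hk.le_of_le hc (by linarith))
      refine ⟨⟨fun _ ↦ ⟨Φ⟩, fun h ↦ absurd his h.ne⟩,
        ⟨fun _ ↦ nonempty_equiv_of_eq_comap κ Φ hup, fun h ↦ absurd his h.ne,
          fun h ↦ absurd his h.ne⟩,
        ⟨fun _ ↦ nonempty_equiv_of_eq_comap κ Φ hdown, fun h ↦ absurd his h.ne,
          fun h ↦ absurd his (h.trans hus).ne⟩,
        fun _ ↦ nonempty_equiv_of_eq_comap κ Φ ?_, fun h ↦ absurd his h.ne,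
        fun h ↦ absurd his h.ne⟩
      rw [hup, hdown, Submodule.comap_inf]
    · obtain ⟨Φ, hup, hup0, hdown, hdown0⟩ := hf.exists_equiv_representative κ r hus.le hst.le hk
        (Or.inr ⟨i, his, hsi, rfl⟩) hj
      have hup (h : c i.succ ≤ t) := hup (hm'.le.trans (hj.le_of_le hc h))
      have hdown (h : u ≤ c i.castSucc) := hdown ((hk.le_of_le hc h).trans hm.le)
      have hup0 (h : t < c i.succ) : upKer κ r f s t = ⊥ := by
        rcases le_castSucc_or_succ_le hc i j with h' | h'
        · exact hup0 (h'.trans_lt hm)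
        · linarith
      have hdown0 (h : c i.castSucc < u) : downKer κ r f s u = ⊥ := by
        rcases le_castSucc_or_succ_le hc i k with h' | h'
        · linarith
        · exact hdown0 (hm'.trans_le h')
      refine ⟨⟨fun h ↦ absurd h his.ne', fun _ ↦ ⟨Φ⟩⟩,
        ⟨fun h ↦ absurd h his.ne', fun _ h ↦ nonempty_equiv_of_eq_comap κ Φ (hup h),
          fun _ h ↦ hup0 h⟩,
        ⟨fun h ↦ absurd h his.ne', fun _ h ↦ nonempty_equiv_of_eq_comap κ Φ (hdown h), hdown0⟩,
        fun h ↦ absurd h his.ne', fun _ hu ht ↦ nonempty_equiv_of_eq_comap κ Φ ?_, fun _ h ↦ ?_⟩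
      · rw [hup ht, hdown hu, Submodule.comap_inf]
      · rcases not_and_or.1 h with h | h
        · rw [hdown0 (not_le.1 h), inf_bot_eq]
        · rw [hup0 (not_le.1 h), bot_inf_eq]
  · obtain ⟨k, hk⟩ := exists_isCeilIndex (hus.trans (hst.trans htN))
    obtain ⟨σ, hσ⟩ := exists_isRepresentative (h0u.trans hus) (hst.trans htN)
    obtain ⟨j, hj⟩ := exists_isFloorIndex (h0u.trans (hus.trans hst))
    exact ⟨k, j, σ, hk, hσ, hj⟩
  · intro k j σ hk hσ hj
    obtain ⟨Φ, hup, hup0, hdown, hdown0⟩ :=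
      hf.exists_equiv_representative κ r hus hst hk hσ hj
    have rank_eq {p : Submodule κ (singH κ r (level f s))}
        {q : Submodule κ (singH κ r (level f σ))} (h : p = q.comap Φ.toLinearMap) :
        Module.rank κ p = Module.rank κ q := by
      obtain ⟨e⟩ := nonempty_equiv_of_eq_comap κ Φ h
      exact e.rank_eq
    have rank_zero {p : Submodule κ (singH κ r (level f s))} (h : p = ⊥) :
        Module.rank κ p = 0 := by
      rw [h, rank_bot]
    refine ⟨Φ.rank_eq, fun h ↦ rank_eq (hup h), fun h ↦ rank_zero (hup0 h),
      fun h ↦ rank_eq (hdown h), fun h ↦ rank_zero (hdown0 h),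
      fun h h' ↦ rank_eq ?_, fun h ↦ rank_zero ?_⟩
    · rw [hup h', hdown h, Submodule.comap_inf]
    · rcases h with h | h
      · rw [hdown0 h, inf_bot_eq]
      · rw [hup0 h, bot_inf_eq]
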